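/- Let $\tau\in\mathbb C$ with $\operatorname{Im}\tau>0$. Write $\mathrm e(z)=\exp(2\pi i z)$, $\Gamma_\tau=\mathbb Z+\mathbb Z\tau$, $\xi=\frac{\tau+1}{2}$, $\alpha(z)=\operatorname{Im}z/\operatorname{Im}\tau$, $\theta(z,\tau)=\sum_{n\in\mathbb Z}\mathrm e(\tau n^2/2+nz)$, and $$\kappa(y,x;\tau)=\sum_{n\in\mathbb Z}\frac{\mathrm e(\tau n^2/2+nx)}{\mathrm e(n\tau)-\mathrm e(y)}\qquad(y\notin\Gamma_\tau).$$ For $\alpha(z_1),\alpha(z_2)\notin\mathbb Z$ let $$h(z_1,z_2;\tau)=\sum_{\substack{(m,n)\in\mathbb Z^2\\(m+\alpha(z_1))(n+\alpha(z_2))>0}}\operatorname{sign}(m+\alpha(z_1))\,\mathrm e\Big(\tfrac{\tau}{2}(2m^2+4mn+n^2)+2(m+n)z_1+(2m+n)z_2\Big),$$ and let $h_0(z_1,z_2;\tau)$ be the series with the same terms in which, for all $z_1,z_2\in\mathbb C$, both $\alpha(z_1)$ and $\alpha(z_2)$ are replaced by $1/2$ in the condition of summation and in the sign. Then: (1) The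 series for $\kappa(y,x;\tau)$ ($y\notin\Gamma_\tau$) and for $h_0(z_1,z_2;\tau)$ (all $z_1,z_2\in\mathbb C$) converge absolutely; $h_0(\cdot,\cdot;\tau)$ is holomorphic on $\mathbb C^2$ and coincides with $h$ in the region $0<\alpha(z_1),\alpha(z_2)<1$. (2) For all $x,y,z\in\mathbb C$ with $2x+y+z\notin\Gamma_\tau$, $$\theta(2x+y,\tau)h_0(x,z;\tau)-\theta(2x+z,\tau)h_0(x,y;\tau)=\theta(2(x+z),2\tau)\,\kappa(-2x-y-z,2x+y+\tau;\tau)-\theta(2(x+y),2\tau)\,\kappa(-2x-y-z,2x+z+\tau;\tau).$$ (3) The function $\psi(x)=\theta(x-\xi,\tau)\,h_0(x,-x;\tau)$ is entire, satisfies $\psi(x+1)=\psi(x)$, and solves the difference equation $$\psi(x+\tau)=\mathrm e(\xi)\psi(x)+\mathrm e(\tfrac{\tau}{2})\,\theta(x,\tau)\,\theta(x-\xi,\tau)+\theta(0,2\tau)\,\theta(x+\xi,\tau);$$ it is the only entire $1$-periodic solution of this equation. (4) For all $x\in\mathbb C$, $$\psi(x)=\theta(0,2\tau)\,\kappa(\xi,x+\xi;\tau)+\theta(\xi,2\tau)\Big(\mathrm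 e(\tfrac{\tau}{2})\,\kappa(\xi,2x-\xi;2\tau)-\mathrm e(x-\tfrac{\tau}{2})\,\kappa(-\xi,2x+\xi;2\tau)\Big).$$ -/

import Mathlib

noncomputable section

namespace FukayaTheta

/-- `e z = exp (2 π i z)`. -/
def ee (z : ℂ) : ℂ := Complex.exp (2 * Real.pi * Complex.I * z)

/-- The lattice `Γ_τ = ℤ + ℤ τ`. -/
def lattice (τ : ℂ) : Set ℂ := {w | ∃ m n : ℤ, w = (m : ℂ) + (n : ℂ) * τ}

/-- The classical theta function `θ(z, τ) = ∑ₙ e(τ n² / 2 + n z)`; this is Mathlib's two-variable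
Jacobi theta function. -/
abbrev theta (z τ : ℂ) : ℂ := jacobiTheta₂ z τ

/-- The zero `ξ = (τ + 1) / 2` of `θ(·, τ)`. -/
def xi (τ : ℂ) : ℂ := (τ + 1) / 2

/-- The `n`-th term of the Appell series `κ(y, x; τ)`. -/
def kappaTerm (y x τ : ℂ) (n : ℤ) : ℂ :=
  ee ((n : ℂ) ^ 2 / 2 * τ + (n : ℂ) * x) / (ee ((n : ℂ) * τ) - ee y)

/-- The Appell series `κ(y, x; τ)`, meaningful for `y ∉ Γ_τ`. -/
def kappa (y x τ : ℂ) : ℂ := ∑' n : ℤ, kappaTerm y x τ n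

/-- `α(z) = Im z / Im τ`. -/
def alpha (τ z : ℂ) : ℝ := z.im / τ.im

/-- The term with index `(m, n)` of the series over `{(m + a)(n + b) > 0}` with sign
`sign (m + a)` and quadratic form `2 m² + 4 m n + n²`. -/
def hTerm (a b : ℝ) (z₁ z₂ τ : ℂ) (p : ℤ × ℤ) : ℂ :=
  if 0 < ((p.1 : ℝ) + a) * ((p.2 : ℝ) + b) then
    ((Real.sign ((p.1 : ℝ) + a) : ℝ) : ℂ) *
      ee (τ / 2 * (2 * (p.1 : ℂ) ^ 2 + 4 * (p.1 : ℂ) * (p.2 : ℂ) + (p.2 : ℂ) ^ 2)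
        + 2 * ((p.1 : ℂ) + (p.2 : ℂ)) * z₁ + (2 * (p.1 : ℂ) + (p.2 : ℂ)) * z₂)
  else 0

/-- The indefinite theta series `h(z₁, z₂; τ)`, for `α(z₁), α(z₂) ∉ ℤ`. -/
def h (z₁ z₂ τ : ℂ) : ℂ :=
  ∑' p : ℤ × ℤ, hTerm (alpha τ z₁) (alpha τ z₂) z₁ z₂ τ p

/-- The function `h₀(z₁, z₂; τ)`: the series which defines `h` in the region
`0 < α(z₁), α(z₂) < 1`, where the condition of summation does not depend on `z₁`, `z₂` and
reads `(m + 1/2)(n + 1/2) > 0`, taken at all `z₁, z₂ ∈ ℂ`. -/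
def h₀ (z₁ z₂ τ : ℂ) : ℂ := ∑' p : ℤ × ℤ, hTerm (1 / 2) (1 / 2) z₁ z₂ τ p

/-- `ψ(x) = θ(x - ξ, τ) h₀(x, -x; τ)`. -/
def psi (τ x : ℂ) : ℂ := theta (x - xi τ) τ * h₀ x (-x) τ

/-- The difference equation
`φ(x + τ) = e((τ+1)/2) φ(x) + e(τ/2) θ(x, τ) θ(x - (τ+1)/2, τ) + θ(0, 2τ) θ(x + (τ+1)/2, τ)`. -/
def SolvesDifferenceEq (τ : ℂ) (φ : ℂ → ℂ) : Prop :=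
  ∀ x : ℂ, φ (x + τ) = ee (xi τ) * φ x
    + ee (τ / 2) * theta x τ * theta (x - xi τ) τ
    + theta 0 (2 * τ) * theta (x + xi τ) τ

end FukayaTheta

end

namespace FukayaTheta

open Complex

/-! Both identities follow from one rigidity fact, `eq_zero_of_quasiperiodic`: an entire 1-periodic
function with constant multiplier `e(y)` under `x ↦ x + τ`, `y ∉ Γ_τ`, vanishes. It remains to see
that the two sides satisfy the same first-order difference equation.

For `κ` this equation is a termwise division (`kappa_add_tau`). For `h₀` it comes from translating
the index by `(1, -1)`, which changes the cone of summation only along the lines `m = 0` and `n =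
-1`; each line sums to a theta function (`h₀_add_sub_tau`).

In the four-term identity, moving `(x, y, z)` to `(x + t, y - t, z - t)` fixes `2x + y + z`, `x + y`
and `x + z`, so the difference of the two sides is quasi-periodic in `t` with multiplier
`e(-2x-y-z)`. For `ψ` the multiplier is `e(ξ)`, and `ξ ∉ Γ_τ` gives uniqueness. The explicit formula
solves the same equation once `θ(x, τ) θ(x - ξ, τ)` is written with theta functions of modulus `2τ`
(`theta_mul_theta_sub_xi`).

Convergence and holomorphy of `h₀` rest on `mn ≥ 0` in the cone: the cross term has modulus at most
1, and a product of two theta series dominates. -/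

lemma ee_add (a b : ℂ) : ee (a + b) = ee a * ee b := by
  simp only [ee, mul_add, Complex.exp_add]

lemma ee_zero : ee 0 = 1 := by simp [ee]

lemma ee_ne_zero (a : ℂ) : ee a ≠ 0 := Complex.exp_ne_zero _

lemma ee_intCast (n : ℤ) : ee n = 1 := by
  rw [ee, mul_comm]; exact Complex.exp_int_mul_two_pi_mul_I n

lemma ee_one : ee 1 = 1 := by simpa using ee_intCast 1

lemma ee_add_intCast (a : ℂ) (n : ℤ) : ee (a + n) = ee a := by
  rw [ee_add, ee_intCast, mul_one]

lemma ee_half : ee (1 / 2) = -1 := by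
  rw [ee, show 2 * (Real.pi : ℂ) * I * (1 / 2) = Real.pi * I by ring, Complex.exp_pi_mul_I]

lemma ee_eq_one_iff {a : ℂ} : ee a = 1 ↔ ∃ n : ℤ, a = n := by
  rw [ee, Complex.exp_eq_one_iff]
  refine exists_congr fun n => ?_
  rw [mul_comm, mul_left_inj' Complex.two_pi_I_ne_zero]

lemma ee_eq_ee_iff {a b : ℂ} : ee a = ee b ↔ ∃ n : ℤ, a = b + n := by
  have : ee a = ee (a - b) * ee b := by rw [← ee_add, sub_add_cancel]
  rw [this, mul_eq_right₀ (ee_ne_zero b), ee_eq_one_iff]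
  exact exists_congr fun n => by rw [sub_eq_iff_eq_add']

lemma norm_ee (a : ℂ) : ‖ee a‖ = Real.exp (-(2 * Real.pi * a.im)) := by
  rw [ee, Complex.norm_exp]
  congr 1
  simp [mul_assoc]

lemma differentiable_ee : Differentiable ℂ ee := by
  unfold ee; fun_prop

lemma jacobiTheta₂_term_eq_ee (n : ℤ) (z τ : ℂ) :
    jacobiTheta₂_term n z τ = ee ((n : ℂ) ^ 2 / 2 * τ + n * z) := by
  rw [jacobiTheta₂_term, ee]
  congr 1
  ring

lemma theta_add_tau (z τ : ℂ) : theta (z + τ) τ = ee (-τ / 2 - z) * theta z τ := by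
  rw [theta, jacobiTheta₂_add_left', ee]
  congr 2
  ring

lemma theta_add_one (z τ : ℂ) : theta (z + 1) τ = theta z τ := jacobiTheta₂_add_left z τ

lemma differentiable_theta {τ : ℂ} (hτ : 0 < τ.im) : Differentiable ℂ (theta · τ) :=
  fun z => differentiableAt_jacobiTheta₂_fst z hτ

/-! ### Liouville's theorem for constant multipliers -/

/-- A continuous function with two independent periods is bounded. -/
lemma exists_bound_of_doubly_periodic {τ : ℂ} (hτ : 0 < τ.im) {F : ℂ → ℝ} (hF : Continuous F)
    (h1 : Function.Periodic F 1) (h2 : Function.Periodic F τ) : ∃ C, ∀ z, F z ≤ C := by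
  have hK : IsCompact (Set.Icc (0 : ℝ) 1 ×ℂ Set.Icc (0 : ℝ) τ.im) :=
    isCompact_Icc.reProdIm isCompact_Icc
  obtain ⟨C, hC⟩ := hK.bddAbove_image hF.continuousOn
  refine ⟨C, fun z => ?_⟩
  set b : ℤ := ⌊z.im / τ.im⌋
  set a : ℤ := ⌊(z - b * τ).re⌋
  have hz : F (z - b * τ - a) = F z := by
    rw [← (h1.int_mul a) (z - b * τ - a), mul_one, sub_add_cancel,
      ← (h2.int_mul b) (z - b * τ), sub_add_cancel]
  rw [← hz]
  refine hC ⟨_, ?_, rfl⟩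
  have hb : (z - b * τ - a).im = Int.fract (z.im / τ.im) * τ.im := by
    rw [Int.fract, sub_mul, div_mul_cancel₀ _ hτ.ne']
    simp [b]
  have ha : (z - b * τ - a).re = Int.fract (z - b * τ).re := by
    rw [Int.fract, sub_re, intCast_re]
  refine ⟨?_, ?_⟩
  · rw [Set.mem_preimage, ha]
    exact ⟨Int.fract_nonneg _, (Int.fract_lt_one _).le⟩
  · rw [Set.mem_preimage, hb]
    exact ⟨mul_nonneg (Int.fract_nonneg _) hτ.le,
      mul_le_of_le_one_left hτ.le (Int.fract_lt_one _).le⟩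

/-- The line bundle on `ℂ / Γ_τ` with multiplier `e(y)`, `y ∉ Γ_τ`, has no sections. -/
lemma eq_zero_of_quasiperiodic {τ y : ℂ} (hτ : 0 < τ.im) (hy : y ∉ lattice τ) {f : ℂ → ℂ}
    (hf : Differentiable ℂ f) (h1 : Function.Periodic f 1) (h2 : ∀ x, f (x + τ) = ee y * f x)
    (x : ℂ) : f x = 0 := by
  -- For this real `s`, `e(-sx)` has modulus 1 at `x = 1` and `|e(y)|⁻¹` at `x = τ`, so `|g|` is
  -- doubly periodic and Liouville makes `g` constant.
  set s : ℝ := y.im / τ.im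
  have hs : (((s : ℂ)) * τ).im = y.im := by
    simp [s, div_mul_cancel₀ _ hτ.ne']
  set g : ℂ → ℂ := fun x => f x * ee (-(s * x))
  have hg : Differentiable ℂ g :=
    hf.mul (differentiable_ee.comp (differentiable_id.const_mul _).neg)
  have g1 : Function.Periodic (fun x => ‖g x‖) 1 := fun x => by
    simp only [g, norm_mul, h1 x, norm_ee]
    simp
  have g2 : Function.Periodic (fun x => ‖g x‖) τ := fun x => by
    simp only [g, norm_mul, h2 x, norm_ee, mul_add, neg_add, add_im, neg_im, hs, Real.exp_add]
    have : Real.exp (-(2 * Real.pi * y.im)) * Real.exp (-(2 * Real.pi * -y.im)) = 1 := by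
      rw [← Real.exp_add]; simp
    linear_combination ‖f x‖ * Real.exp (-(2 * Real.pi * -((s : ℂ) * x).im)) * this
  obtain ⟨C, hC⟩ := exists_bound_of_doubly_periodic hτ hg.continuous.norm g1 g2
  have hb : Bornology.IsBounded (Set.range g) :=
    isBounded_iff_forall_norm_le.2 ⟨C, by rintro _ ⟨z, rfl⟩; exact hC z⟩
  obtain ⟨c, hc⟩ := hg.exists_const_forall_eq_of_bounded hb
  have hfc : ∀ x, f x = c * ee (s * x) := fun x => by
    rw [← hc x, mul_assoc, ← ee_add, neg_add_cancel, ee_zero, mul_one]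
  rw [hfc]
  by_cases hc0 : c = 0
  · rw [hc0, zero_mul]
  -- A nonzero multiple of `e(sx)` has the two multipliers only if `s ∈ ℤ` and `y - sτ ∈ ℤ`.
  exfalso
  have e1 : ee (s : ℂ) = 1 := by
    have := h1 0
    rw [hfc, hfc] at this
    simpa [ee_zero, hc0] using this
  have e2 : ee y = ee (s * τ) := by
    have := h2 0
    rw [hfc, hfc] at this
    simpa [ee_zero, hc0, mul_comm] using this.symm
  obtain ⟨n, hn⟩ := ee_eq_one_iff.1 e1
  obtain ⟨m, hm⟩ := ee_eq_ee_iff.1 e2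
  exact hy ⟨m, n, by rw [hm, hn, add_comm]⟩

/-! ### The Appell series -/

lemma kappaTerm_eq (y x τ : ℂ) (n : ℤ) :
    kappaTerm y x τ n = jacobiTheta₂_term n x τ / (ee (n * τ) - ee y) := by
  rw [kappaTerm, jacobiTheta₂_term_eq_ee]

lemma ee_sub_ne_zero {τ y : ℂ} (hy : y ∉ lattice τ) (n : ℤ) : ee (n * τ) - ee y ≠ 0 := fun h => by
  obtain ⟨m, hm⟩ := ee_eq_ee_iff.1 (sub_eq_zero.1 h).symm
  exact hy ⟨m, n, by rw [hm, add_comm]⟩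

/-- The denominators of `κ` are bounded away from zero. -/
lemma exists_norm_inv_le {τ : ℂ} (hτ : 0 < τ.im) (y : ℂ) :
    ∃ C : ℝ, ∀ n : ℤ, ‖(ee (n * τ) - ee y)⁻¹‖ ≤ C := by
  set c : ℝ := ‖ee y‖
  have hc : 0 < c := norm_pos_iff.2 (ee_ne_zero y)
  set s : ℝ := y.im / τ.im
  have hs : s * τ.im = y.im := div_mul_cancel₀ _ hτ.ne'
  have hnorm : ∀ n : ℤ, ‖ee (n * τ)‖ = c * Real.exp (-(2 * Real.pi * τ.im * (n - s))) := by
    intro n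
    change _ = ‖ee y‖ * _
    rw [norm_ee, norm_ee, ← Real.exp_add]
    congr 1
    rw [← hs]
    simp
    ring
  -- When `n` is at distance at least 1 from `s`, the moduli of `e(nτ)` and `e(y)` already differ by
  -- a fixed amount; finitely many `n` remain. If a denominator vanishes there, its inverse is 0 by
  -- convention, so `y` may be arbitrary.
  have hbig : ∃ δ > 0, ∀ n : ℤ, (n : ℝ) ≤ s - 1 ∨ s + 1 ≤ (n : ℝ) →
      δ ≤ ‖ee (n * τ) - ee y‖ := by
    set q : ℝ := Real.exp (-(2 * Real.pi * τ.im))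
    have hT : 0 < 2 * Real.pi * τ.im := by positivity
    have hq : q < 1 := by rw [← Real.exp_zero]; exact Real.exp_lt_exp.2 (by linarith)
    refine ⟨c * (1 - q), mul_pos hc (by linarith), fun n hn => ?_⟩
    rcases hn with hn | hn
    · refine le_trans ?_ (norm_sub_norm_le _ _)
      rw [hnorm]
      have : 1 + 2 * Real.pi * τ.im ≤ Real.exp (-(2 * Real.pi * τ.im * (n - s))) := by
        refine le_trans ?_ (Real.add_one_le_exp _)
        nlinarith
      have h2 : 1 - 2 * Real.pi * τ.im ≤ q := by
        have := Real.add_one_le_exp (-(2 * Real.pi * τ.im)); linarith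
      change _ ≤ c * _ - c
      nlinarith
    · rw [norm_sub_rev]
      refine le_trans ?_ (norm_sub_norm_le _ _)
      rw [hnorm]
      have : Real.exp (-(2 * Real.pi * τ.im * (n - s))) ≤ q :=
        Real.exp_le_exp.2 (by nlinarith)
      change _ ≤ c - c * _
      nlinarith
  obtain ⟨δ, hδ, hδ'⟩ := hbig
  refine ⟨δ⁻¹ + ∑ n ∈ Finset.Icc ⌈s - 1⌉ ⌊s + 1⌋, ‖(ee (n * τ) - ee y)⁻¹‖,
    fun n => ?_⟩
  by_cases hn : (n : ℝ) ≤ s - 1 ∨ s + 1 ≤ (n : ℝ)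
  · refine le_add_of_le_of_nonneg ?_ (Finset.sum_nonneg fun _ _ => norm_nonneg _)
    rw [norm_inv]
    exact inv_anti₀ hδ (hδ' n hn)
  · rw [not_or, not_le, not_le] at hn
    refine le_add_of_nonneg_of_le (by positivity) ?_
    exact Finset.single_le_sum (f := fun n : ℤ => ‖(ee (n * τ) - ee y)⁻¹‖)
      (fun _ _ => norm_nonneg _)
      (Finset.mem_Icc.2 ⟨Int.ceil_le.2 hn.1.le, Int.le_floor.2 hn.2.le⟩)

lemma summable_kappaTerm {τ : ℂ} (hτ : 0 < τ.im) (y x : ℂ) :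
    Summable (kappaTerm y x τ) := by
  obtain ⟨C, hC⟩ := exists_norm_inv_le hτ y
  refine Summable.of_norm_bounded
    (((summable_jacobiTheta₂_term_iff x τ).2 hτ).norm.mul_right C) fun n => ?_
  rw [kappaTerm_eq, div_eq_mul_inv, norm_mul]
  exact mul_le_mul_of_nonneg_left (hC n) (norm_nonneg _)

lemma differentiable_kappa {τ : ℂ} (hτ : 0 < τ.im) (y : ℂ) :
    Differentiable ℂ (kappa y · τ) := by
  obtain ⟨C, hC⟩ := exists_norm_inv_le hτ y
  intro x
  obtain ⟨S, hS⟩ := exists_gt |x.im|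
  have hV : IsOpen {u : ℂ | |u.im| < S} :=
    (_root_.continuous_abs.comp continuous_im).isOpen_preimage _ isOpen_Iio
  refine (differentiableOn_tsum_of_summable_norm
    ((summable_pow_mul_jacobiTheta₂_term_bound S hτ 0).mul_right C)
    (fun n => Differentiable.differentiableOn ?_) hV fun n w hw => ?_).differentiableAt
      (hV.mem_nhds hS)
  · simp only [kappaTerm]
    exact (differentiable_ee.comp ((differentiable_id.const_mul _).const_add _)).div_const _
  · rw [kappaTerm_eq, div_eq_mul_inv, norm_mul, pow_zero, one_mul]
    exact mul_le_mul (norm_jacobiTheta₂_term_le hτ (le_of_lt hw) le_rfl n) (hC n)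
      (norm_nonneg _) (Real.exp_pos _).le

lemma kappa_add_one (y x τ : ℂ) : kappa y (x + 1) τ = kappa y x τ := by
  refine tsum_congr fun n => ?_
  rw [kappaTerm, kappaTerm, mul_add, mul_one, ← add_assoc, ee_add_intCast]

/-- The shift multiplies the `n`-th term by `e(nτ) = e(y) + (e(nτ) - e(y))`, and the second summand
cancels the denominator. -/
lemma kappa_add_tau {τ y : ℂ} (hτ : 0 < τ.im) (hy : y ∉ lattice τ) (x : ℂ) :
    kappa y (x + τ) τ = ee y * kappa y x τ + theta x τ := by
  have h := ((summable_kappaTerm hτ y x).hasSum.mul_left (ee y)).add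
    (hasSum_jacobiTheta₂_term x hτ)
  refine HasSum.tsum_eq (h.congr_fun ?_)
  intro n
  rw [kappaTerm_eq, kappaTerm_eq, jacobiTheta₂_term_eq_ee, jacobiTheta₂_term_eq_ee, mul_add,
    ← add_assoc, ee_add]
  have := ee_sub_ne_zero hy n
  field_simp
  ring

/-! ### The indefinite theta series -/

/-- The exponential with index `(m, n)` in the series for `h` and `h₀`. -/
noncomputable def hExp (z₁ z₂ τ : ℂ) (p : ℤ × ℤ) : ℂ :=
  ee (τ / 2 * (2 * (p.1 : ℂ) ^ 2 + 4 * (p.1 : ℂ) * (p.2 : ℂ) + (p.2 : ℂ) ^ 2)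
    + 2 * ((p.1 : ℂ) + (p.2 : ℂ)) * z₁ + (2 * (p.1 : ℂ) + (p.2 : ℂ)) * z₂)

/-- The sign of the cone which contains `(m, n)`: `1` for `0 ≤ m, n`, `-1` for `m, n < 0`. -/
noncomputable def coneSign (p : ℤ × ℤ) : ℂ := (if 0 ≤ p.1 then 1 else 0) - (if p.2 < 0 then 1 else 0)

/-- For `0 < c < 1` the sign of `k + c` depends only on whether `0 ≤ k`. Writing the result as a
difference of half-plane indicators makes index translations easy to follow. -/
lemma hTerm_of_mem_Ioo {a b : ℝ} (ha : a ∈ Set.Ioo (0 : ℝ) 1) (hb : b ∈ Set.Ioo (0 : ℝ) 1)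
    (z₁ z₂ τ : ℂ) (p : ℤ × ℤ) : hTerm a b z₁ z₂ τ p = coneSign p * hExp z₁ z₂ τ p := by
  obtain ⟨m, n⟩ := p
  have pos : ∀ {c : ℝ} {k : ℤ}, c ∈ Set.Ioo (0 : ℝ) 1 → 0 ≤ k → 0 < (k : ℝ) + c :=
    fun hc hk => add_pos_of_nonneg_of_pos (Int.cast_nonneg hk) hc.1
  have neg : ∀ {c : ℝ} {k : ℤ}, c ∈ Set.Ioo (0 : ℝ) 1 → k < 0 → (k : ℝ) + c < 0 := by
    intro c k hc hk
    have : (k : ℝ) ≤ -1 := by exact_mod_cast Int.le_sub_one_of_lt hk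
    linarith [hc.2]
  simp only [hTerm, coneSign, hExp]
  rcases le_or_gt 0 m with hm | hm <;> rcases le_or_gt 0 n with hn | hn
  · rw [if_pos (mul_pos (pos ha hm) (pos hb hn)), Real.sign_of_pos (pos ha hm), if_pos hm,
      if_neg hn.not_gt]
    simp
  · rw [if_neg (mul_neg_of_pos_of_neg (pos ha hm) (neg hb hn)).not_gt, if_pos hm, if_pos hn]
    simp
  · rw [if_neg (mul_neg_of_neg_of_pos (neg ha hm) (pos hb hn)).not_gt, if_neg hm.not_ge,
      if_neg hn.not_gt]
    simp
  · rw [if_pos (mul_pos_of_neg_of_neg (neg ha hm) (neg hb hn)), Real.sign_of_neg (neg ha hm),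
      if_neg hm.not_ge, if_pos hn]
    simp

lemma hTerm_half (z₁ z₂ τ : ℂ) (p : ℤ × ℤ) :
    hTerm (1 / 2) (1 / 2) z₁ z₂ τ p = coneSign p * hExp z₁ z₂ τ p :=
  hTerm_of_mem_Ioo (by norm_num) (by norm_num) z₁ z₂ τ p

lemma hExp_eq (z₁ z₂ τ : ℂ) (p : ℤ × ℤ) :
    hExp z₁ z₂ τ p = ee (2 * p.1 * p.2 * τ) *
      (jacobiTheta₂_term p.1 (2 * z₁ + 2 * z₂) (2 * τ) * jacobiTheta₂_term p.2 (2 * z₁ + z₂) τ) := by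
  rw [jacobiTheta₂_term_eq_ee, jacobiTheta₂_term_eq_ee, ← ee_add, ← ee_add, hExp]
  congr 1
  ring

lemma norm_coneSign_mul_hExp_le {τ : ℂ} (hτ : 0 < τ.im) (z₁ z₂ : ℂ) (p : ℤ × ℤ) :
    ‖coneSign p * hExp z₁ z₂ τ p‖ ≤
      ‖jacobiTheta₂_term p.1 (2 * z₁ + 2 * z₂) (2 * τ)‖ *
        ‖jacobiTheta₂_term p.2 (2 * z₁ + z₂) τ‖ := by
  obtain ⟨m, n⟩ := p
  rw [hExp_eq, ← mul_assoc, norm_mul, norm_mul, norm_mul]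
  refine mul_le_of_le_one_left (by positivity) ?_
  have key : 0 ≤ m * n → ‖ee (2 * m * n * τ)‖ ≤ 1 := fun h => by
    rw [norm_ee, Real.exp_le_one_iff, neg_nonpos]
    have : (2 * (m : ℂ) * n * τ).im = 2 * ((m * n : ℤ) : ℝ) * τ.im := by
      rw [show 2 * (m : ℂ) * n * τ = ((2 * (m * n : ℤ) : ℝ) : ℂ) * τ by push_cast; ring,
        im_ofReal_mul]
    rw [this]
    have : (0 : ℝ) ≤ ((m * n : ℤ) : ℝ) := Int.cast_nonneg h
    positivity
  simp only [coneSign]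
  rcases le_or_gt 0 m with hm | hm <;> rcases le_or_gt 0 n with hn | hn
  · simpa [hm, hn.not_gt] using key (mul_nonneg hm hn)
  · simp [hm, hn]
  · simp [hm.not_ge, hn.not_gt]
  · simpa [hm.not_ge, hn] using key (mul_nonneg_of_nonpos_of_nonpos hm.le hn.le)

lemma summable_coneSign_mul_hExp {τ : ℂ} (hτ : 0 < τ.im) (z₁ z₂ : ℂ) :
    Summable fun p => coneSign p * hExp z₁ z₂ τ p := by
  have h2τ : 0 < (2 * τ).im := by simpa using hτ
  refine Summable.of_norm_bounded (Summable.mul_of_nonneg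
    ((summable_jacobiTheta₂_term_iff (2 * z₁ + 2 * z₂) (2 * τ)).2 h2τ).norm
    ((summable_jacobiTheta₂_term_iff (2 * z₁ + z₂) τ).2 hτ).norm
    (fun _ => norm_nonneg _) fun _ => norm_nonneg _) (norm_coneSign_mul_hExp_le hτ z₁ z₂)

lemma h₀_eq_tsum (z₁ z₂ τ : ℂ) : h₀ z₁ z₂ τ = ∑' p, coneSign p * hExp z₁ z₂ τ p :=
  tsum_congr (hTerm_half z₁ z₂ τ)

lemma hasSum_h₀ {τ : ℂ} (hτ : 0 < τ.im) (z₁ z₂ : ℂ) :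
    HasSum (fun p => coneSign p * hExp z₁ z₂ τ p) (h₀ z₁ z₂ τ) := by
  rw [h₀_eq_tsum]
  exact (summable_coneSign_mul_hExp hτ z₁ z₂).hasSum

lemma h₀_eq_h {τ z₁ z₂ : ℂ} (h₁ : alpha τ z₁ ∈ Set.Ioo (0 : ℝ) 1)
    (h₂ : alpha τ z₂ ∈ Set.Ioo (0 : ℝ) 1) : h₀ z₁ z₂ τ = h z₁ z₂ τ := by
  rw [h₀_eq_tsum, h]
  exact (tsum_congr (hTerm_of_mem_Ioo h₁ h₂ z₁ z₂ τ)).symm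

/-- The derivative of `hExp` in `(z₁, z₂)`. -/
noncomputable def hExpFDeriv (z : ℂ × ℂ) (τ : ℂ) (p : ℤ × ℤ) : ℂ × ℂ →L[ℂ] ℂ :=
  hExp z.1 z.2 τ p • ((2 * Real.pi * I) • ((2 * ((p.1 : ℂ) + p.2)) • ContinuousLinearMap.fst ℂ ℂ ℂ
    + (2 * (p.1 : ℂ) + p.2) • ContinuousLinearMap.snd ℂ ℂ ℂ))

lemma hasFDerivAt_hExp (z : ℂ × ℂ) (τ : ℂ) (p : ℤ × ℤ) :
    HasFDerivAt (fun z : ℂ × ℂ => hExp z.1 z.2 τ p) (hExpFDeriv z τ p) z := by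
  unfold hExpFDeriv hExp ee
  exact ((((hasFDerivAt_fst.const_mul _).const_add _).add
    (hasFDerivAt_snd.const_mul _)).const_mul _).cexp

lemma norm_hExpFDeriv_le (z : ℂ × ℂ) (τ : ℂ) (p : ℤ × ℤ) :
    ‖hExpFDeriv z τ p‖ ≤
      8 * Real.pi * ((1 + |(p.1 : ℝ)|) * (1 + |(p.2 : ℝ)|)) * ‖hExp z.1 z.2 τ p‖ := by
  have hns (a : ℂ) (f : (ℂ × ℂ) →L[ℂ] ℂ) : ‖a • f‖ = ‖a‖ * ‖f‖ := norm_smul a f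
  have hpi : ‖2 * (Real.pi : ℂ) * I‖ = 2 * Real.pi := by
    simp [abs_of_pos Real.pi_pos]
  obtain ⟨m, n⟩ := p
  have hA : ‖2 * ((m : ℂ) + n)‖ ≤ 2 * (|(m : ℝ)| + |(n : ℝ)|) := by
    rw [norm_mul, Complex.norm_two]
    refine mul_le_mul_of_nonneg_left ((norm_add_le _ _).trans_eq ?_) (by norm_num)
    simp [Complex.norm_intCast]
  have hB : ‖2 * (m : ℂ) + n‖ ≤ 2 * |(m : ℝ)| + |(n : ℝ)| := by
    refine (norm_add_le _ _).trans_eq ?_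
    simp [Complex.norm_intCast]
  have hL : ‖(2 * ((m : ℂ) + n)) • ContinuousLinearMap.fst ℂ ℂ ℂ
      + (2 * (m : ℂ) + n) • ContinuousLinearMap.snd ℂ ℂ ℂ‖
        ≤ 4 * ((1 + |(m : ℝ)|) * (1 + |(n : ℝ)|)) := by
    refine (norm_add_le _ _).trans ?_
    rw [hns, hns]
    have h1 := mul_le_mul hA (ContinuousLinearMap.norm_fst_le ℂ ℂ ℂ) (norm_nonneg _) (by positivity)
    have h2 := mul_le_mul hB (ContinuousLinearMap.norm_snd_le ℂ ℂ ℂ) (norm_nonneg _) (by positivity)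
    have := mul_nonneg (abs_nonneg (m : ℝ)) (abs_nonneg (n : ℝ))
    nlinarith [abs_nonneg (n : ℝ), abs_nonneg (m : ℝ)]
  rw [hExpFDeriv, hns, hns, hpi]
  calc _ ≤ ‖hExp z.1 z.2 τ (m, n)‖ *
        (2 * Real.pi * (4 * ((1 + |(m : ℝ)|) * (1 + |(n : ℝ)|)))) := by gcongr
    _ = _ := by ring

lemma differentiable_h₀ {τ : ℂ} (hτ : 0 < τ.im) :
    Differentiable ℂ (fun z : ℂ × ℂ => h₀ z.1 z.2 τ) := by
  intro z
  obtain ⟨S, hS⟩ := exists_gt (max |z.1.im| |z.2.im|)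
  have h2τ : τ.im ≤ (2 * τ).im := by simp; linarith
  let U : Set ℂ := {u | |u.im| < S}
  have hUo : IsOpen U := (_root_.continuous_abs.comp continuous_im).isOpen_preimage _ isOpen_Iio
  have hUc : IsPreconnected U := by
    refine Convex.isPreconnected ?_
    simpa only [U, abs_lt] using! (convex_halfSpace_im_gt (-S)).inter (convex_halfSpace_im_lt S)
  -- One majorant serves both indices: `4 * S` bounds the imaginary parts of both theta arguments,
  -- `τ.im` bounds both moduli from below, and the linear factor absorbs the derivative.
  let b : ℤ → ℝ := fun n =>
    (1 + |(n : ℝ)|) * Real.exp (-Real.pi * (τ.im * n ^ 2 - 2 * (4 * S) * |n|))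
  have hb0 : ∀ n, 0 ≤ b n := fun n => by positivity
  have hb : Summable b := by
    refine ((summable_pow_mul_jacobiTheta₂_term_bound (4 * S) hτ 0).add
      (summable_pow_mul_jacobiTheta₂_term_bound (4 * S) hτ 1)).congr fun n => ?_
    simp only [b]
    push_cast
    ring
  have hz : z ∈ U ×ˢ U := ⟨(le_max_left _ _).trans_lt hS, (le_max_right _ _).trans_lt hS⟩
  simp only [h₀_eq_tsum]
  refine (hasFDerivAt_tsum_of_isPreconnected
    (f := fun p (z : ℂ × ℂ) => coneSign p * hExp z.1 z.2 τ p)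
    (f' := fun p z => coneSign p • hExpFDeriv z τ p)
    (u := fun p => 8 * Real.pi * (b p.1 * b p.2))
    ((hb.mul_of_nonneg hb hb0 hb0).mul_left (8 * Real.pi)) (hUo.prod hUo) (hUc.prod hUc)
    (fun p w _ => (hasFDerivAt_hExp w τ p).const_mul _) (fun p w hw => ?_) hz
    (summable_coneSign_mul_hExp hτ z.1 z.2) hz).differentiableAt
  obtain ⟨hw1, hw2⟩ : |w.1.im| < S ∧ |w.2.im| < S := hw
  have e1 : |(2 * w.1 + 2 * w.2).im| ≤ 4 * S := by
    have : (2 * w.1 + 2 * w.2).im = 2 * w.1.im + 2 * w.2.im := by simp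
    rw [this, abs_le]
    rw [abs_lt] at hw1 hw2
    constructor <;> linarith [hw1.1, hw1.2, hw2.1, hw2.2]
  have e2 : |(2 * w.1 + w.2).im| ≤ 4 * S := by
    have : (2 * w.1 + w.2).im = 2 * w.1.im + w.2.im := by simp
    rw [this, abs_le]
    rw [abs_lt] at hw1 hw2
    constructor <;> linarith [hw1.1, hw1.2, hw2.1, hw2.2]
  have hns : ‖coneSign p • hExpFDeriv w τ p‖ = ‖coneSign p‖ * ‖hExpFDeriv w τ p‖ := norm_smul _ _
  rw [hns]
  calc _ ≤ ‖coneSign p‖ *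
        (8 * Real.pi * ((1 + |(p.1 : ℝ)|) * (1 + |(p.2 : ℝ)|)) * ‖hExp w.1 w.2 τ p‖) :=
      mul_le_mul_of_nonneg_left (norm_hExpFDeriv_le w τ p) (norm_nonneg _)
    _ = 8 * Real.pi * ((1 + |(p.1 : ℝ)|) * (1 + |(p.2 : ℝ)|)) *
        ‖coneSign p * hExp w.1 w.2 τ p‖ := by rw [norm_mul]; ring
    _ ≤ 8 * Real.pi * ((1 + |(p.1 : ℝ)|) * (1 + |(p.2 : ℝ)|)) *
        (Real.exp (-Real.pi * (τ.im * p.1 ^ 2 - 2 * (4 * S) * |p.1|)) *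
          Real.exp (-Real.pi * (τ.im * p.2 ^ 2 - 2 * (4 * S) * |p.2|))) := by
      refine mul_le_mul_of_nonneg_left ?_ (by positivity)
      exact (norm_coneSign_mul_hExp_le hτ w.1 w.2 p).trans
        (mul_le_mul (norm_jacobiTheta₂_term_le hτ e1 h2τ p.1)
          (norm_jacobiTheta₂_term_le hτ e2 le_rfl p.2) (norm_nonneg _) (Real.exp_pos _).le)
    _ = _ := by simp only [b]; ring

lemma h₀_add_sub_one (z₁ z₂ τ : ℂ) : h₀ (z₁ + 1) (z₂ - 1) τ = h₀ z₁ z₂ τ := by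
  rw [h₀_eq_tsum, h₀_eq_tsum]
  refine tsum_congr fun p => ?_
  rw [hExp, hExp, ee_eq_ee_iff.2 ⟨p.2, ?_⟩]
  ring

/-- The difference equation of `h₀` along the direction `(τ, -τ)`. -/
lemma h₀_add_sub_tau {τ : ℂ} (hτ : 0 < τ.im) (z₁ z₂ : ℂ) :
    h₀ (z₁ + τ) (z₂ - τ) τ = ee (τ / 2 - z₂) * (h₀ z₁ z₂ τ - theta (2 * z₁ + z₂) τ)
      + theta (2 * (z₁ + z₂)) (2 * τ) := by
  have h2τ : 0 < (2 * τ).im := by simpa using hτ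
  let i₁ : ℤ → ℤ × ℤ := fun n => (0, n)
  -- On `n = -1` the form is `2(m - 1)² - 1`, so `m = k + 1` completes the square.
  let i₂ : ℤ → ℤ × ℤ := fun k => (k + 1, -1)
  have hi₁ : Function.Injective i₁ := fun a b hab => (Prod.ext_iff.1 hab).2
  have hi₂ : Function.Injective i₂ := fun a b hab => add_right_cancel (Prod.ext_iff.1 hab).1
  have s₁ : HasSum (fun p : ℤ × ℤ => (if p.1 = 0 then 1 else 0) * hExp z₁ z₂ τ p)
      (theta (2 * z₁ + z₂) τ) := by
    rw [← hi₁.hasSum_iff]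
    · refine (hasSum_jacobiTheta₂_term (2 * z₁ + z₂) hτ).congr_fun fun n => ?_
      rw [jacobiTheta₂_term_eq_ee]
      simp only [i₁, Function.comp, if_true, one_mul, hExp]
      congr 1
      push_cast
      ring
    · rintro ⟨m, n⟩ hp
      rw [if_neg, zero_mul]
      rintro rfl
      exact hp ⟨n, rfl⟩
  have s₂ : HasSum (fun p : ℤ × ℤ => (if p.2 = -1 then 1 else 0) * hExp z₁ z₂ τ p)
      (ee (z₂ - τ / 2) * theta (2 * (z₁ + z₂)) (2 * τ)) := by
    rw [← hi₂.hasSum_iff]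
    · refine ((hasSum_jacobiTheta₂_term (2 * (z₁ + z₂)) h2τ).mul_left _).congr_fun fun k => ?_
      rw [jacobiTheta₂_term_eq_ee, ← ee_add]
      simp only [i₂, Function.comp, if_true, one_mul, hExp]
      congr 1
      push_cast
      ring
    · rintro ⟨m, n⟩ hp
      rw [if_neg, zero_mul]
      rintro rfl
      exact hp ⟨m - 1, by simp [i₂]⟩
  -- Removing `m = 0` and adding `n = -1` gives the weight `[1 ≤ m] - [n < -1]`, which `(m, n) ↦ (m
  -- + 1, n - 1)` pulls back to `coneSign`.
  have s := (((hasSum_h₀ hτ z₁ z₂).sub s₁).add s₂).mul_left (ee (τ / 2 - z₂))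
  have e := (Equiv.prodCongr (Equiv.addRight (1 : ℤ)) (Equiv.subRight (1 : ℤ))).hasSum_iff.2 s
  have h := e.unique ((hasSum_h₀ hτ (z₁ + τ) (z₂ - τ)).congr_fun ?_)
  · rw [← h, mul_add, ← mul_assoc, ← ee_add, sub_add_sub_cancel, sub_self, ee_zero, one_mul]
  rintro ⟨m, n⟩
  simp only [Function.comp, Equiv.prodCongr_apply, Prod.map_apply, Equiv.coe_addRight,
    Equiv.subRight_apply, ← sub_mul, ← add_mul]
  rw [mul_left_comm, hExp, hExp, ← ee_add]
  congr 1
  · simp only [coneSign]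
    split_ifs <;> first | omega | norm_num
  · congr 1
    push_cast
    ring

/-! ### The four-term identity and the difference equation -/

lemma neg_mem_lattice {τ w : ℂ} (hw : w ∈ lattice τ) : -w ∈ lattice τ := by
  obtain ⟨m, n, rfl⟩ := hw
  exact ⟨-m, -n, by push_cast; ring⟩

lemma differentiable_h₀_comp {τ : ℂ} (hτ : 0 < τ.im) {f g : ℂ → ℂ} (hf : Differentiable ℂ f)
    (hg : Differentiable ℂ g) : Differentiable ℂ fun t => h₀ (f t) (g t) τ :=
  Differentiable.comp (g := fun z : ℂ × ℂ => h₀ z.1 z.2 τ) (f := fun t => (f t, g t))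
    (differentiable_h₀ hτ) (hf.prodMk hg)

lemma four_term_identity {τ : ℂ} (hτ : 0 < τ.im) {x y z : ℂ}
    (hw : 2 * x + y + z ∉ lattice τ) :
    theta (2 * x + y) τ * h₀ x z τ - theta (2 * x + z) τ * h₀ x y τ
      = theta (2 * (x + z)) (2 * τ) * kappa (-2 * x - y - z) (2 * x + y + τ) τ
        - theta (2 * (x + y)) (2 * τ) * kappa (-2 * x - y - z) (2 * x + z + τ) τ := by
  set w := -2 * x - y - z with hwdef
  have hw' : w ∉ lattice τ := fun h => hw (by
    have := neg_mem_lattice h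
    rwa [hwdef, show -(-2 * x - y - z) = 2 * x + y + z by ring] at this)
  set A := theta (2 * (x + z)) (2 * τ) with hA
  set B := theta (2 * (x + y)) (2 * τ) with hB
  let D : ℂ → ℂ := fun t =>
    theta (2 * x + y + t) τ * h₀ (x + t) (z - t) τ - theta (2 * x + z + t) τ * h₀ (x + t) (y - t) τ
      - (A * kappa w (2 * x + y + τ + t) τ - B * kappa w (2 * x + z + τ + t) τ)
  have dθ : ∀ c, Differentiable ℂ fun t => theta (c + t) τ := fun c =>
    (differentiable_theta hτ).comp (differentiable_id.const_add c)
  have dκ : ∀ c, Differentiable ℂ fun t => kappa w (c + t) τ := fun c =>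
    (differentiable_kappa hτ w).comp (differentiable_id.const_add c)
  have dh : ∀ c, Differentiable ℂ fun t => h₀ (x + t) (c - t) τ := fun c =>
    differentiable_h₀_comp hτ (differentiable_id.const_add x) (differentiable_id.const_sub c)
  have hD : Differentiable ℂ D :=
    (((dθ _).mul (dh _)).sub ((dθ _).mul (dh _))).sub
      (((dκ _).const_mul A).sub ((dκ _).const_mul B))
  have h1 : Function.Periodic D 1 := fun t => by
    simp only [D, ← add_assoc, ← sub_sub, theta_add_one, kappa_add_one, h₀_add_sub_one]
  have h2 : ∀ t, D (t + τ) = ee w * D t := fun t => by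
    have eA : 2 * (x + t + (z - t)) = 2 * (x + z) := by ring
    have eB : 2 * (x + t + (y - t)) = 2 * (x + y) := by ring
    have eu : 2 * (x + t) + (z - t) = 2 * x + z + t := by ring
    have ev : 2 * (x + t) + (y - t) = 2 * x + y + t := by ring
    have eu' : 2 * x + y + τ + t = 2 * x + y + t + τ := by ring
    have ev' : 2 * x + z + τ + t = 2 * x + z + t + τ := by ring
    simp only [D, ← add_assoc, ← sub_sub]
    rw [h₀_add_sub_tau hτ, h₀_add_sub_tau hτ, kappa_add_tau hτ hw', kappa_add_tau hτ hw', eA, eB,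
      eu, ev, eu', ev', theta_add_tau, theta_add_tau, ← hA, ← hB]
    have f1 : ee (-τ / 2 - (2 * x + y + t)) * ee (τ / 2 - (z - t)) = ee w := by
      rw [← ee_add, hwdef]; congr 1; ring
    have f2 : ee (-τ / 2 - (2 * x + z + t)) * ee (τ / 2 - (y - t)) = ee w := by
      rw [← ee_add, hwdef]; congr 1; ring
    -- The products `θ(2x+y+t) θ(2x+z+t)` from the two `h₀` terms carry the same factor `e(w)` and
    -- cancel.
    linear_combination theta (2 * x + y + t) τ *
        (h₀ (x + t) (z - t) τ - theta (2 * x + z + t) τ) * f1 -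
      theta (2 * x + z + t) τ * (h₀ (x + t) (y - t) τ - theta (2 * x + y + t) τ) * f2
  have := eq_zero_of_quasiperiodic hτ hw' hD h1 h2 0
  simp only [D, add_zero, sub_zero] at this
  exact sub_eq_zero.1 this

lemma differentiable_psi {τ : ℂ} (hτ : 0 < τ.im) : Differentiable ℂ (psi τ) :=
  ((differentiable_theta hτ).comp (differentiable_id.sub_const _)).mul
    (differentiable_h₀_comp hτ differentiable_id differentiable_id.neg)

lemma psi_periodic (τ : ℂ) : Function.Periodic (psi τ) 1 := fun x => by
  rw [psi, psi, neg_add, ← sub_eq_add_neg, h₀_add_sub_one, add_sub_right_comm, theta_add_one]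

lemma ee_xi (τ : ℂ) : ee (xi τ) = -ee (τ / 2) := by
  rw [xi, add_div, ee_add, ee_half, mul_neg_one]

/-- The factor `θ(x - ξ, τ)` turns the multiplier `e(τ/2 + x)` of `h₀(x, -x; τ)` into the constant
`e(ξ) = -e(τ/2)`. -/
lemma psi_solvesDifferenceEq {τ : ℂ} (hτ : 0 < τ.im) : SolvesDifferenceEq τ (psi τ) := fun x => by
  have e1 : theta (x + xi τ) τ = theta (x - xi τ + τ) τ := by
    rw [← theta_add_one (x - xi τ + τ)]
    congr 1
    simp only [xi]
    ring
  have e2 : ee (-τ / 2 - (x - xi τ)) * ee (τ / 2 + x) = ee (xi τ) := by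
    rw [← ee_add]; congr 1; ring
  have e3 : 2 * x + -x = x := by ring
  rw [e1, psi, psi, neg_add, ← sub_eq_add_neg, h₀_add_sub_tau hτ, add_sub_right_comm, theta_add_tau,
    sub_neg_eq_add, e3, add_neg_cancel, mul_zero]
  linear_combination theta (x - xi τ) τ * (h₀ x (-x) τ - theta x τ) * e2
    - theta (x - xi τ) τ * theta x τ * ee_xi τ

lemma xi_notMem_lattice {τ : ℂ} (hτ : 0 < τ.im) : xi τ ∉ lattice τ := by
  rintro ⟨m, n, h⟩
  have h' := congrArg Complex.im h
  simp only [xi, add_im, div_ofNat_im, one_im, intCast_im, mul_im, intCast_re, add_zero, zero_mul,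
    zero_add] at h'
  have : (n : ℝ) * 2 = 1 := mul_right_cancel₀ hτ.ne' (by linarith)
  norm_cast at this
  omega

lemma xi_notMem_lattice_two_mul {τ : ℂ} (hτ : 0 < τ.im) : xi τ ∉ lattice (2 * τ) := by
  rintro ⟨m, n, h⟩
  exact xi_notMem_lattice hτ ⟨m, n * 2, by rw [h]; push_cast; ring⟩

lemma solution_unique {τ : ℂ} (hτ : 0 < τ.im) {φ φ' : ℂ → ℂ} (hφ : Differentiable ℂ φ)
    (hφ' : Differentiable ℂ φ') (h1 : Function.Periodic φ 1) (h1' : Function.Periodic φ' 1)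
    (h2 : SolvesDifferenceEq τ φ) (h2' : SolvesDifferenceEq τ φ') : φ = φ' := by
  funext x
  refine sub_eq_zero.1 (eq_zero_of_quasiperiodic hτ (xi_notMem_lattice hτ) (hφ.sub hφ')
    (fun x => ?_) (fun x => ?_) x)
  · rw [Pi.sub_apply, h1, h1', Pi.sub_apply]
  · rw [Pi.sub_apply, h2, h2', Pi.sub_apply]
    ring

/-! ### Addition formula for theta and the explicit form of `ψ` -/

lemma hasSum_theta_mul_theta {σ : ℂ} (hσ : 0 < σ.im) (c d : ℂ) :
    HasSum (fun p : ℤ × ℤ => jacobiTheta₂_term p.1 c σ * jacobiTheta₂_term p.2 d σ)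
      (theta c σ * theta d σ) := by
  have h := summable_mul_of_summable_norm (f := fun n => jacobiTheta₂_term n c σ)
    (g := fun n => jacobiTheta₂_term n d σ) ((summable_jacobiTheta₂_term_iff c σ).2 hσ).norm
    ((summable_jacobiTheta₂_term_iff d σ).2 hσ).norm
  exact HasSum.mul (f := fun n => jacobiTheta₂_term n c σ)
    (g := fun n => jacobiTheta₂_term n d σ) (hasSum_jacobiTheta₂_term c hσ)
    (hasSum_jacobiTheta₂_term d hσ) h

/-- The addition formula which expresses `θ(a, τ) θ(b, τ)` by theta functions of modulus `2τ`. -/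
lemma theta_mul_theta {τ : ℂ} (hτ : 0 < τ.im) (a b : ℂ) :
    theta a τ * theta b τ = theta (a + b) (2 * τ) * theta (a - b) (2 * τ)
      + ee (τ / 2 + a) * (theta (a + b + τ) (2 * τ) * theta (a - b + τ) (2 * τ)) := by
  have h2τ : 0 < (2 * τ).im := by simpa using hτ
  -- The two maps parametrise the index pairs of even and of odd sum; the rotation diagonalises the
  -- form with modulus `2τ`.
  let i₀ : ℤ × ℤ → ℤ × ℤ := fun p => (p.1 + p.2, p.1 - p.2)
  let i₁ : ℤ × ℤ → ℤ × ℤ := fun p => (p.1 + p.2 + 1, p.1 - p.2)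
  have hi₀ : Function.Injective i₀ := fun p q h => by
    simp only [i₀, Prod.mk.injEq] at h
    exact Prod.ext (by omega) (by omega)
  have hi₁ : Function.Injective i₁ := fun p q h => by
    simp only [i₁, Prod.mk.injEq] at h
    exact Prod.ext (by omega) (by omega)
  have hc : IsCompl (Set.range i₀) (Set.range i₁) := by
    refine ⟨Set.disjoint_left.2 ?_, codisjoint_iff_le_sup.2 fun p _ => ?_⟩
    · rintro _ ⟨p, rfl⟩ ⟨q, h⟩
      simp only [i₀, i₁, Prod.mk.injEq] at h
      omega
    · rcases Int.even_or_odd' (p.1 + p.2) with ⟨k, hk | hk⟩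
      · exact Or.inl ⟨(k, p.1 - k), Prod.ext (by simp only [i₀]; omega) (by simp only [i₀]; omega)⟩
      · exact Or.inr ⟨(k, p.1 - k - 1), Prod.ext (by simp only [i₁]; omega) (by simp only [i₁]; omega)⟩
  have h₀ := hi₀.hasSum_range_iff
    (f := fun p : ℤ × ℤ => jacobiTheta₂_term p.1 a τ * jacobiTheta₂_term p.2 b τ)
      (a := theta (a + b) (2 * τ) * theta (a - b) (2 * τ))
  have h₁ := hi₁.hasSum_range_iff
    (f := fun p : ℤ × ℤ => jacobiTheta₂_term p.1 a τ * jacobiTheta₂_term p.2 b τ)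
      (a := ee (τ / 2 + a) * (theta (a + b + τ) (2 * τ) * theta (a - b + τ) (2 * τ)))
  refine (hasSum_theta_mul_theta hτ a b).unique ((h₀.2 ?_).add_isCompl hc (h₁.2 ?_))
  · refine (hasSum_theta_mul_theta h2τ (a + b) (a - b)).congr_fun fun p => ?_
    simp only [Function.comp, i₀, jacobiTheta₂_term_eq_ee, ← ee_add]
    congr 1
    push_cast
    ring
  · refine ((hasSum_theta_mul_theta h2τ (a + b + τ) (a - b + τ)).mul_left _).congr_fun fun p => ?_
    simp only [Function.comp, i₁, jacobiTheta₂_term_eq_ee, ← ee_add]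
    congr 1
    push_cast
    ring

/-- Modulus `2τ` and argument `2x` suit the equation of `κ(·, 2x ∓ ξ; 2τ)`, since `x ↦ x + τ` moves
`2x` by `2τ`. As `2ξ = τ + 1`, evenness of theta reduces both coefficients to `θ(ξ, 2τ)`. -/
lemma theta_mul_theta_sub_xi {τ : ℂ} (hτ : 0 < τ.im) (x : ℂ) :
    theta x τ * theta (x - xi τ) τ = theta (xi τ) (2 * τ) *
      (theta (2 * x - xi τ) (2 * τ) - ee x * theta (2 * x + xi τ) (2 * τ)) := by
  have e1 : theta (xi τ + τ) (2 * τ) = ee (-xi τ) * theta (xi τ) (2 * τ) := by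
    rw [show xi τ + τ = -xi τ + 1 + 2 * τ by simp only [xi]; ring, theta_add_tau, theta_add_one,
      theta, jacobiTheta₂_neg_left]
    congr 2
    simp only [xi]
    ring
  have e2 : theta (2 * x + xi τ) (2 * τ) = theta (2 * x - xi τ + τ) (2 * τ) := by
    rw [← theta_add_one (2 * x - xi τ + τ)]
    congr 1
    simp only [xi]
    ring
  have e3 : ee (τ / 2 + x) * ee (-xi τ) = -ee x := by
    rw [← mul_neg_one (ee x), ← ee_half, ← ee_add, ← ee_add]
    refine ee_eq_ee_iff.2 ⟨-1, ?_⟩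
    simp only [xi]
    push_cast
    ring
  rw [theta_mul_theta hτ, show x + (x - xi τ) = 2 * x - xi τ by ring, sub_sub_cancel, e1, ← e2]
  linear_combination theta (2 * x + xi τ) (2 * τ) * theta (xi τ) (2 * τ) * e3

lemma psi_eq_kappa {τ : ℂ} (hτ : 0 < τ.im) (x : ℂ) :
    psi τ x = theta 0 (2 * τ) * kappa (xi τ) (x + xi τ) τ
      + theta (xi τ) (2 * τ) * (ee (τ / 2) * kappa (xi τ) (2 * x - xi τ) (2 * τ)
        - ee (x - τ / 2) * kappa (-xi τ) (2 * x + xi τ) (2 * τ)) := by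
  have h2τ : 0 < (2 * τ).im := by simpa using hτ
  have hξ := xi_notMem_lattice hτ
  have hξ2 := xi_notMem_lattice_two_mul hτ
  have hξ2' : -xi τ ∉ lattice (2 * τ) := fun h => hξ2 (by simpa using neg_mem_lattice h)
  refine congrFun (solution_unique hτ (differentiable_psi hτ) (φ' := fun x =>
    theta 0 (2 * τ) * kappa (xi τ) (x + xi τ) τ
      + theta (xi τ) (2 * τ) * (ee (τ / 2) * kappa (xi τ) (2 * x - xi τ) (2 * τ)
        - ee (x - τ / 2) * kappa (-xi τ) (2 * x + xi τ) (2 * τ))) ?_ (psi_periodic τ) ?_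
    (psi_solvesDifferenceEq hτ) ?_) x
  · have d1 := (differentiable_kappa hτ (xi τ)).comp (differentiable_id.add_const (xi τ))
    have d2 := (differentiable_kappa h2τ (xi τ)).comp
      ((differentiable_id.const_mul 2).sub_const (xi τ))
    have d3 := (differentiable_kappa h2τ (-xi τ)).comp
      ((differentiable_id.const_mul 2).add_const (xi τ))
    have d4 := differentiable_ee.comp (differentiable_id.sub_const (τ / 2))
    exact (d1.const_mul _).add (((d2.const_mul _).sub (d4.mul d3)).const_mul _)
  · intro x
    have k2 : ∀ c, kappa (xi τ) (c + 2) (2 * τ) = kappa (xi τ) c (2 * τ) := fun c => by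
      rw [← one_add_one_eq_two, ← add_assoc, kappa_add_one, kappa_add_one]
    have k2' : ∀ c, kappa (-xi τ) (c + 2) (2 * τ) = kappa (-xi τ) c (2 * τ) := fun c => by
      rw [← one_add_one_eq_two, ← add_assoc, kappa_add_one, kappa_add_one]
    simp only [mul_add, mul_one]
    rw [add_right_comm x, kappa_add_one, add_sub_right_comm, k2, add_right_comm (2 * x), k2',
      add_sub_right_comm, ee_add, ee_one, mul_one]
  · intro x
    -- The prefactor `e(x - τ/2)` contributes `e(τ) = e(2ξ)`, correcting the multiplier `e(-ξ)` of
    -- the last Appell series to `e(ξ)`.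
    have e1 : ee (x + τ - τ / 2) * ee (-xi τ) = ee (xi τ) * ee (x - τ / 2) := by
      rw [← ee_add, ← ee_add]
      refine ee_eq_ee_iff.2 ⟨-1, ?_⟩
      simp only [xi]
      push_cast
      ring
    have e2 : ee (x + τ - τ / 2) = ee (τ / 2) * ee x := by
      rw [← ee_add]; congr 1; ring
    simp only [mul_add]
    rw [add_right_comm x, kappa_add_tau hτ hξ, add_sub_right_comm, kappa_add_tau h2τ hξ2,
      add_right_comm (2 * x), kappa_add_tau h2τ hξ2']
    linear_combination (-ee (τ / 2)) * theta_mul_theta_sub_xi hτ x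
      - theta (xi τ) (2 * τ) * kappa (-xi τ) (2 * x + xi τ) (2 * τ) * e1
      - theta (xi τ) (2 * τ) * theta (2 * x + xi τ) (2 * τ) * e2

end FukayaTheta

theorem mainTheorem10 (τ : ℂ) (hτ : 0 < τ.im) :
    -- the series converge absolutely
    (∀ y x : ℂ, y ∉ FukayaTheta.lattice τ → Summable (FukayaTheta.kappaTerm y x τ)) ∧
    (∀ z₁ z₂ : ℂ, Summable (FukayaTheta.hTerm (1 / 2) (1 / 2) z₁ z₂ τ)) ∧
    -- `h₀` is the holomorphic extension to `ℂ²` of the restriction of `h` to `0 < α(zᵢ) < 1`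
    Differentiable ℂ (fun p : ℂ × ℂ => FukayaTheta.h₀ p.1 p.2 τ) ∧
    (∀ z₁ z₂ : ℂ, FukayaTheta.alpha τ z₁ ∈ Set.Ioo (0 : ℝ) 1 →
      FukayaTheta.alpha τ z₂ ∈ Set.Ioo (0 : ℝ) 1 →
      FukayaTheta.h₀ z₁ z₂ τ = FukayaTheta.h z₁ z₂ τ) ∧
    -- the four-term identity
    (∀ x y z : ℂ, 2 * x + y + z ∉ FukayaTheta.lattice τ →
      FukayaTheta.theta (2 * x + y) τ * FukayaTheta.h₀ x z τ
        - FukayaTheta.theta (2 * x + z) τ * FukayaTheta.h₀ x y τ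
      = FukayaTheta.theta (2 * (x + z)) (2 * τ)
          * FukayaTheta.kappa (-2 * x - y - z) (2 * x + y + τ) τ
        - FukayaTheta.theta (2 * (x + y)) (2 * τ)
          * FukayaTheta.kappa (-2 * x - y - z) (2 * x + z + τ) τ) ∧
    -- `ψ` is the unique holomorphic `1`-periodic solution of the difference equation
    (Differentiable ℂ (FukayaTheta.psi τ) ∧ Function.Periodic (FukayaTheta.psi τ) 1 ∧
      FukayaTheta.SolvesDifferenceEq τ (FukayaTheta.psi τ)) ∧
    (∀ φ : ℂ → ℂ, Differentiable ℂ φ → Function.Periodic φ 1 →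
      FukayaTheta.SolvesDifferenceEq τ φ → φ = FukayaTheta.psi τ) ∧
    -- the explicit formula for `ψ(x) = θ(x - (τ+1)/2, τ) h₀(x, -x; τ)`
    (∀ x : ℂ, FukayaTheta.psi τ x
      = FukayaTheta.theta 0 (2 * τ)
          * FukayaTheta.kappa ((τ + 1) / 2) (x + (τ + 1) / 2) τ
        + FukayaTheta.theta ((τ + 1) / 2) (2 * τ)
          * (FukayaTheta.ee (τ / 2)
              * FukayaTheta.kappa ((τ + 1) / 2) (2 * x - (τ + 1) / 2) (2 * τ)
            - FukayaTheta.ee (x - τ / 2)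
              * FukayaTheta.kappa (-((τ + 1) / 2)) (2 * x + (τ + 1) / 2) (2 * τ))) := by
  have hd := FukayaTheta.differentiable_psi hτ
  have hp := FukayaTheta.psi_periodic τ
  have hs := FukayaTheta.psi_solvesDifferenceEq hτ
  exact ⟨fun y x _ => FukayaTheta.summable_kappaTerm hτ y x,
    fun z₁ z₂ => (FukayaTheta.summable_coneSign_mul_hExp hτ z₁ z₂).congr fun p =>
      (FukayaTheta.hTerm_half z₁ z₂ τ p).symm,
    FukayaTheta.differentiable_h₀ hτ,
    fun _ _ h₁ h₂ => FukayaTheta.h₀_eq_h h₁ h₂,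
    fun _ _ _ hw => FukayaTheta.four_term_identity hτ hw,
    ⟨hd, hp, hs⟩,
    fun _ h₁ h₂ h₃ => FukayaTheta.solution_unique hτ h₁ hd h₂ hp h₃ hs,
    FukayaTheta.psi_eq_kappa hτ⟩
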